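/- Proposition (Lévy's Equivalences). Let $\mathscr{G}$ be a commutative semigroup (not necessarily with identity) with a metric $d$ such that $d(ac,bc)=d(a,b)=d(ca,cb)$ for all $a,b,c\in\mathscr{G}$. Assume that $(\mathscr{G},d)$ is complete and separable, and that $\mathscr{G}$ is normed: there is a nonempty set $J\neq\{1\}$ of positive integers such that $d(z,z^{n+1})=n\,d(z,z^2)$ for all $n\in J$ and $z\in\mathscr{G}$. Let $X_1,X_2,\dots$ be independent Borel random variables with values in $\mathscr{G}$ on a probability space $(\Omega,\mathscr{A},\mu)$, and put $S_n:=X_1X_2\cdots X_n$ for $n\geq 1$. Then the following are equivalent: (1) $S_n$ converges almost surely, i.e. for $\mu$-almost every $\omega$ the sequence $(S_n(\omega))_n$ has a limit in $\mathscr{G}$; (2) $S_n$ converges in probability, i.e. there is a random variable $Z:\Omega\to\mathscr{G}$ such that $\mu(d(S_n,Z)\geq\varepsilon)\to 0$ for every $\varepsilon>0$; (3) $S_n$ converges in distribution, i.e. the laws of $S_n$ converge weakly to some Borel probability measure on $\mathscr{G}$. -/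

import Mathlib

open MeasureTheory ProbabilityTheory Filter Topology

/-- A metric semigroup: a semigroup whose metric is invariant under right and left translations. -/
structure IsMetricSemigroup (G : Type*) [Semigroup G] [MetricSpace G] : Prop where
  dist_mul_right : ∀ a b c : G, dist (a * c) (b * c) = dist a b
  dist_mul_left : ∀ a b c : G, dist (c * a) (c * b) = dist a b

/-- `powSucc z n` is the power `z ^ (n + 1)` in a semigroup (no identity element is needed). -/
def powSucc {G : Type*} [Semigroup G] (z : G) : ℕ → G
  | 0 => z
  | n + 1 => powSucc z n * z

/-- `J`-normed, for a set `J` of positive integers: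
`d(z, z ^ (n + 1)) = n d(z, z ^ 2)` for all `n ∈ J` and all `z`. -/
def IsNormedOn (G : Type*) [Semigroup G] [MetricSpace G] (J : Set ℕ+) : Prop :=
  ∀ n ∈ J, ∀ z : G, dist z (powSucc z (n : ℕ)) = ((n : ℕ) : ℝ) * dist z (powSucc z 1)

/-- A semigroup with a metric is normed if it is `J`-normed for some nonempty set `J ≠ {1}` of
positive integers. -/
def IsNormedSemigroup (G : Type*) [Semigroup G] [MetricSpace G] : Prop :=
  ∃ J : Set ℕ+, J.Nonempty ∧ J ≠ {1} ∧ IsNormedOn G J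

/-- The partial products `X 0 * X 1 * ⋯ * X n` of a sequence of `G`-valued functions; the factors
are indexed from `0`, so there is always at least one of them. -/
def partialProd {Ω G : Type*} [Semigroup G] (X : ℕ → Ω → G) : ℕ → Ω → G
  | 0 => X 0
  | n + 1 => fun ω => partialProd X n ω * X (n + 1) ω

section Convergence

variable {Ω G : Type*} [MeasurableSpace Ω] [MetricSpace G]

/-- The sequence `S` converges almost surely. -/
def ConvergesAlmostSurely (S : ℕ → Ω → G) (μ : Measure Ω) : Prop :=
  ∀ᵐ ω ∂μ, ∃ z : G, Tendsto (fun n => S n ω) atTop (𝓝 z)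

/-- The sequence `S` converges in probability to some `G`-valued random variable. -/
def ConvergesInProbability [MeasurableSpace G] (S : ℕ → Ω → G) (μ : Measure Ω) : Prop :=
  ∃ Z : Ω → G, Measurable Z ∧ TendstoInMeasure μ S atTop Z

/-- The sequence `S` converges in distribution: the laws of the `S n` converge weakly to some
Borel probability measure `ν` on `G` (the law of the identity map under `ν`). -/
def ConvergesInDistribution [MeasurableSpace G] [BorelSpace G] (S : ℕ → Ω → G)
    (μ : Measure Ω) [IsProbabilityMeasure μ] : Prop :=
  ∃ ν : ProbabilityMeasure G,
    TendstoInDistribution S atTop (id : G → G) (fun _ => μ) (ν : Measure G)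

end Convergence

/-!
The displacement `d(z, z * z)` of `z` equals `d(a, a * z)` for every `a`, so the distance between
two partial products is the displacement of the block of factors that separates them, which is
independent of the earlier factors. Almost sure convergence implies convergence in probability,
which implies convergence in distribution, on general grounds; the content of the theorem is that
convergence in distribution implies almost sure convergence.

Suppose that the laws of the partial products converge weakly to `ν`. They form a tight family;
since the quotients of elements of a compact set form a compact set
(`IsMetricSemigroup.isCompact_setOf_mul_mem`), so do the laws of all blocks, and by Prokhorov's
theorem the laws of blocks starting later and later have limit points `ρ`. These satisfy
`ν ∗ ρ = ν`. For a bounded continuous function `g`, the function `h a = ∫ z, g (a * z) ∂ν` is then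
harmonic for `ρ`, and comparing second moments gives `h (a * w) = h a` for almost every `(a, w)`
under `ν ⊗ ρ` (`ae_integral_mul_eq`). Hence the translates of `ν` by `a * w` and by `a` agree for
`(a, w)` in the support (`map_mul_eq_of_mem_support`), and so do those by `a * x` and by `a` for
all `x` in the subsemigroup generated by `w`. A single probability measure being tight, the
displacements of these `x` are bounded; as the semigroup is normed, displacements grow without
bound along suitable powers of `w` unless `w` has displacement zero. So `ρ` is carried by elements
of displacement zero (`ae_displacement_eq_zero`), which says that the partial products are Cauchy
in probability (`cauchyInProbability_of_tendsto_law`). No embedding into a Banach space and no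
characteristic functions are needed.

Finally the Lévy–Ottaviani inequality (`measure_exists_le_displacement_partialProd_le`), whose
proof uses only the invariance of the metric, upgrades the Cauchy property in probability to almost
sure convergence (`CauchyInProbability.convergesAlmostSurely`).
-/

/-! ### Metric semigroups -/

/-- The displacement of `z`: the distance by which translation by `z` moves any point, see
`IsMetricSemigroup.dist_self_mul`. It plays the part of the norm of `z`; in the absence of an
identity it is measured at the point `z` itself. -/
noncomputable def displacement {G : Type*} [Semigroup G] [MetricSpace G] (z : G) : ℝ :=
  dist z (z * z)

namespace IsMetricSemigroup

variable {G : Type*} [CommSemigroup G] [MetricSpace G]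

lemma dist_self_mul (hG : IsMetricSemigroup G) (a z : G) : dist a (a * z) = displacement z := by
  rw [displacement, ← hG.dist_mul_left z (z * z) a, ← mul_assoc, hG.dist_mul_right]

lemma dist_mul_mul_le (hG : IsMetricSemigroup G) (a b a' b' : G) :
    dist (a * b) (a' * b') ≤ dist a a' + dist b b' := by
  have h := dist_triangle (a * b) (a' * b) (a' * b')
  rwa [hG.dist_mul_right, hG.dist_mul_left] at h

lemma continuousMul (hG : IsMetricSemigroup G) : ContinuousMul G := by
  refine ⟨(LipschitzWith.of_dist_le_mul (K := 2) fun p q => ?_).continuous⟩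
  have h := hG.dist_mul_mul_le p.1 p.2 q.1 q.2
  have h1 : dist p.1 q.1 ≤ dist p q := le_max_left _ _
  have h2 : dist p.2 q.2 ≤ dist p q := le_max_right _ _
  push_cast
  linarith

lemma continuous_displacement (hG : IsMetricSemigroup G) :
    Continuous (displacement : G → ℝ) := by
  have := hG.continuousMul
  unfold displacement
  fun_prop

lemma displacement_le_add (hG : IsMetricSemigroup G) (x y : G) :
    displacement x ≤ displacement (x * y) + displacement y := by
  have h := dist_triangle_right x (x * x) (x * (x * y))
  rw [← hG.dist_self_mul x x, ← hG.dist_self_mul x (x * y), ← hG.dist_self_mul (x * x) y]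
  simpa [mul_assoc] using h

/-- In a complete metric semigroup, the quotients of elements of a compact set form a compact
set. -/
lemma isCompact_setOf_mul_mem [CompleteSpace G] (hG : IsMetricSemigroup G) {K : Set G}
    (hK : IsCompact K) : IsCompact {w : G | ∃ a ∈ K, a * w ∈ K} := by
  have := hG.continuousMul
  -- `(a, w) ↦ (a, a * w)` is bi-Lipschitz on a complete space, so its image is closed.
  have hanti : AntilipschitzWith 2 fun p : G × G => (p.1, p.1 * p.2) := by
    refine AntilipschitzWith.of_le_mul_dist fun p q => ?_
    have h1 : dist p.1 q.1 ≤ dist (p.1, p.1 * p.2) (q.1, q.1 * q.2) := le_max_left _ _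
    have h2 : dist (p.1 * p.2) (q.1 * q.2) ≤ dist (p.1, p.1 * p.2) (q.1, q.1 * q.2) :=
      le_max_right _ _
    have h3 := dist_triangle (p.1 * p.2) (q.1 * q.2) (p.1 * q.2)
    rw [hG.dist_mul_left, hG.dist_mul_right, dist_comm q.1] at h3
    push_cast
    refine max_le ?_ ?_
    · have := dist_nonneg.trans h1
      linarith
    · linarith
  have hlip : LipschitzWith 2 fun p : G × G => (p.1, p.1 * p.2) := by
    refine LipschitzWith.of_dist_le_mul fun p q => ?_
    have h := hG.dist_mul_mul_le p.1 p.2 q.1 q.2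
    have h1 : dist p.1 q.1 ≤ dist p q := le_max_left _ _
    have h2 : dist p.2 q.2 ≤ dist p q := le_max_right _ _
    push_cast
    refine max_le ?_ ?_
    · have := dist_nonneg.trans h1
      change dist p.1 q.1 ≤ _
      linarith
    · change dist (p.1 * p.2) (q.1 * q.2) ≤ _
      linarith
  have hc := ((hanti.isClosedEmbedding hlip.uniformContinuous).isCompact_preimage
    (hK.prod hK)).image continuous_snd
  convert hc using 1
  ext w
  constructor
  · rintro ⟨a, ha, haw⟩
    exact ⟨(a, w), ⟨ha, haw⟩, rfl⟩
  · rintro ⟨⟨a, w'⟩, ⟨ha, haw⟩, rfl⟩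
    exact ⟨a, ha, haw⟩

end IsMetricSemigroup

lemma powSucc_mem {G : Type*} [Semigroup G] (P : Subsemigroup G) {z : G} (hz : z ∈ P) (n : ℕ) :
    powSucc z n ∈ P := by
  induction n with
  | zero => exact hz
  | succ n ih => exact P.mul_mem ih hz

/-- In a normed semigroup an element of nonzero displacement generates an unbounded
subsemigroup: taking `n`-th powers multiplies displacements by `n`, for some `n ≥ 2`. -/
lemma IsNormedSemigroup.displacement_eq_zero {G : Type*} [CommSemigroup G] [MetricSpace G]
    (hnorm : IsNormedSemigroup G) (hG : IsMetricSemigroup G) (P : Subsemigroup G) {C : ℝ}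
    (hC : ∀ z ∈ P, displacement z ≤ C) {z : G} (hz : z ∈ P) : displacement z = 0 := by
  obtain ⟨J, ⟨k, hk⟩, hJ1, hJ⟩ := hnorm
  obtain ⟨n, hn, hn1⟩ : ∃ n ∈ J, n ≠ 1 := by
    by_contra! h
    exact hJ1 (Set.eq_singleton_iff_unique_mem.2 ⟨h k hk ▸ hk, h⟩)
  obtain ⟨m, hm⟩ : ∃ m, (n : ℕ) = m + 1 := ⟨_, (Nat.succ_pred_eq_of_pos n.pos).symm⟩
  have hn2 : (1 : ℝ) < (n : ℕ) := by
    have : (n : ℕ) ≠ 1 := fun h => hn1 (PNat.coe_eq_one_iff.1 h)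
    exact_mod_cast lt_of_le_of_ne n.pos this.symm
  have hpow (x : G) : displacement (powSucc x m) = ((n : ℕ) : ℝ) * displacement x := by
    have h := hJ n hn x
    rw [hm] at h ⊢
    rwa [show powSucc x (m + 1) = x * powSucc x m from mul_comm _ _, hG.dist_self_mul] at h
  have hbound (j : ℕ) : ∀ x ∈ P, ((n : ℕ) : ℝ) ^ j * displacement x ≤ C := by
    induction j with
    | zero => simpa using hC
    | succ j ih =>
      intro x hx
      have h := ih _ (powSucc_mem P hx m)
      rwa [hpow, ← mul_assoc, ← pow_succ] at h
  by_contra hne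
  have hpos : 0 < displacement z := lt_of_le_of_ne dist_nonneg (Ne.symm hne)
  obtain ⟨j, hj⟩ := pow_unbounded_of_one_lt (C / displacement z) hn2
  rw [div_lt_iff₀ hpos] at hj
  exact absurd (hbound j z hz) (not_le.2 hj)

/-! ### Measures invariant under convolution -/

section Invariant

variable {G : Type*} [CommSemigroup G] [TopologicalSpace G] [SecondCountableTopology G]
  [ContinuousMul G] [MeasurableSpace G] [BorelSpace G]

/-- If `ν` is invariant under convolution with `ρ`, the function `h a = ∫ z, g (a * z) ∂ν` is
constant along almost every translation: it is harmonic for `ρ`, and a bounded harmonic function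
has orthogonal increments, whereas `h` has the same second moment before and after a step. -/
lemma ae_integral_mul_eq (ν ρ : Measure G) [IsProbabilityMeasure ν] [IsProbabilityMeasure ρ]
    (h : (ν.prod ρ).map (fun p => p.1 * p.2) = ν) (g : BoundedContinuousFunction G ℝ) :
    ∀ᵐ p ∂(ν.prod ρ), ∫ z, g (p.1 * p.2 * z) ∂ν = ∫ z, g (p.1 * z) ∂ν := by
  set H : G → ℝ := fun a => ∫ z, g (a * z) ∂ν with hH
  have hgb (x : G) : ‖g x‖ ≤ ‖g‖ := g.norm_coe_le_norm x
  have hHm : StronglyMeasurable H := by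
    refine StronglyMeasurable.integral_prod_right (f := fun a z => g (a * z)) ?_
    exact (g.continuous.comp continuous_mul).stronglyMeasurable
  have hHb (x : G) : ‖H x‖ ≤ ‖g‖ := by
    refine (norm_integral_le_of_norm_le_const (C := ‖g‖) (ae_of_all _ fun z => hgb _)).trans ?_
    simp
  have hmul : Measurable fun p : G × G => p.1 * p.2 := measurable_mul
  -- The harmonicity of `H`.
  have hharm (a : G) : ∫ w, H (a * w) ∂ρ = H a := by
    have hint : Integrable (fun p : G × G => g (a * (p.1 * p.2))) (ν.prod ρ) :=
      Integrable.of_bound (C := ‖g‖) (by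
        exact (g.continuous.comp (by fun_prop)).aestronglyMeasurable) (ae_of_all _ fun _ => hgb _)
    calc ∫ w, H (a * w) ∂ρ = ∫ w, ∫ z, g (a * (z * w)) ∂ν ∂ρ := by
          simp only [hH, show ∀ w z, a * w * z = a * (z * w) from fun w z => by ac_rfl]
      _ = ∫ p, g (a * (p.1 * p.2)) ∂(ν.prod ρ) := (integral_prod_symm _ hint).symm
      _ = ∫ z, g (a * z) ∂((ν.prod ρ).map fun p => p.1 * p.2) := by
          rw [integral_map hmul.aemeasurable]
          exact (g.continuous.comp (by fun_prop)).aestronglyMeasurable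
      _ = H a := by rw [h]
  have hHmul : StronglyMeasurable fun p : G × G => H (p.1 * p.2) := hHm.comp_measurable hmul
  have hHfst : StronglyMeasurable fun p : G × G => H p.1 := hHm.comp_measurable measurable_fst
  have hHb2 (x y : G) : ‖H x * H y‖ ≤ ‖g‖ * ‖g‖ := by
    rw [norm_mul]
    exact mul_le_mul (hHb x) (hHb y) (norm_nonneg _) (norm_nonneg _)
  have i1 : Integrable (fun p : G × G => H (p.1 * p.2) * H (p.1 * p.2)) (ν.prod ρ) :=
    Integrable.of_bound (hHmul.mul hHmul).aestronglyMeasurable _ (ae_of_all _ fun _ => hHb2 _ _)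
  have i2 : Integrable (fun p : G × G => H p.1 * H p.1) (ν.prod ρ) :=
    Integrable.of_bound (hHfst.mul hHfst).aestronglyMeasurable _ (ae_of_all _ fun _ => hHb2 _ _)
  have i3 : Integrable (fun p : G × G => H p.1 * H (p.1 * p.2)) (ν.prod ρ) :=
    Integrable.of_bound (hHfst.mul hHmul).aestronglyMeasurable _ (ae_of_all _ fun _ => hHb2 _ _)
  have i12 : Integrable (fun p : G × G => H (p.1 * p.2) * H (p.1 * p.2) + H p.1 * H p.1)
      (ν.prod ρ) := i1.add i2
  have e1 : ∫ p, H (p.1 * p.2) * H (p.1 * p.2) ∂(ν.prod ρ) = ∫ a, H a * H a ∂ν := by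
    conv_rhs => rw [← h]
    exact (integral_map hmul.aemeasurable (hHm.mul hHm).aestronglyMeasurable).symm
  have e2 : ∫ p, H p.1 * H p.1 ∂(ν.prod ρ) = ∫ a, H a * H a ∂ν := by
    rw [integral_prod _ i2]
    simp
  have e3 : ∫ p, H p.1 * H (p.1 * p.2) ∂(ν.prod ρ) = ∫ a, H a * H a ∂ν := by
    rw [integral_prod _ i3]
    simp only [integral_const_mul, hharm]
  have hsq : ∫ p, (H (p.1 * p.2) - H p.1) ^ 2 ∂(ν.prod ρ) = 0 := by
    have : ∀ p : G × G, (H (p.1 * p.2) - H p.1) ^ 2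
        = H (p.1 * p.2) * H (p.1 * p.2) + H p.1 * H p.1 - 2 * (H p.1 * H (p.1 * p.2)) :=
      fun p => by ring
    simp only [this]
    rw [integral_sub i12 (i3.const_mul 2), integral_add i1 i2, integral_const_mul,
      e1, e2, e3]
    ring
  have hint : Integrable (fun p : G × G => (H (p.1 * p.2) - H p.1) ^ 2) (ν.prod ρ) := by
    refine (i12.sub (i3.const_mul 2)).congr (ae_of_all _ fun p => ?_)
    simp only [Pi.sub_apply]
    ring
  rw [integral_eq_zero_iff_of_nonneg (fun p => sq_nonneg _) hint] at hsq
  filter_upwards [hsq] with p hp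
  exact sub_eq_zero.1 (pow_eq_zero_iff two_ne_zero |>.1 hp)

/-- A form of the Choquet–Deny theorem. -/
lemma map_mul_eq_of_mem_support [HasOuterApproxClosed G] (ν ρ : Measure G)
    [IsProbabilityMeasure ν]
    [IsProbabilityMeasure ρ] (h : (ν.prod ρ).map (fun p => p.1 * p.2) = ν) {a w : G}
    (haw : (a, w) ∈ (ν.prod ρ).support) : ν.map (a * w * ·) = ν.map (a * ·) := by
  have hc (b : G) : Continuous (b * · : G → G) := continuous_const_mul b
  have := Measure.isProbabilityMeasure_map (μ := ν) (hc (a * w)).aemeasurable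
  have := Measure.isProbabilityMeasure_map (μ := ν) (hc a).aemeasurable
  refine ext_of_forall_integral_eq_of_IsFiniteMeasure fun g => ?_
  rw [integral_map (hc _).aemeasurable g.continuous.aestronglyMeasurable,
    integral_map (hc _).aemeasurable g.continuous.aestronglyMeasurable]
  have hHc : Continuous fun b => ∫ z, g (b * z) ∂ν :=
    continuous_of_dominated (bound := fun _ => ‖g‖)
      (fun b => (g.continuous.comp (hc b)).aestronglyMeasurable)
      (fun b => ae_of_all _ fun z => g.norm_coe_le_norm _) (integrable_const _)
      (ae_of_all _ fun z => g.continuous.comp (continuous_mul_const z))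
  exact Measure.support_subset_of_isClosed
    (isClosed_eq (hHc.comp continuous_mul) (hHc.comp continuous_fst))
    (ae_integral_mul_eq ν ρ h g) haw

end Invariant

/-- Convolution by a probability measure `ρ` on a normed metric semigroup can only fix a
probability measure if `ρ` is carried by elements of displacement zero. -/
lemma ae_displacement_eq_zero {G : Type*} [CommSemigroup G] [MetricSpace G]
    [SecondCountableTopology G] [MeasurableSpace G] [BorelSpace G]
    (hG : IsMetricSemigroup G) (hnorm : IsNormedSemigroup G) (ν ρ : Measure G)
    [IsProbabilityMeasure ν] [IsProbabilityMeasure ρ]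
    (h : (ν.prod ρ).map (fun p => p.1 * p.2) = ν) : ∀ᵐ w ∂ρ, displacement w = 0 := by
  have := hG.continuousMul
  have hsupp : ∀ᵐ p ∂(ν.prod ρ), displacement p.2 = 0 := by
    filter_upwards [Measure.support_mem_ae (μ := ν.prod ρ)] with ⟨a, w⟩ haw
    have hc (b : G) : Continuous (b * · : G → G) := continuous_const_mul b
    -- The periods of the translate of `ν` by `a`.
    let P : Subsemigroup G :=
      { carrier := {x | ν.map (a * x * ·) = ν.map (a * ·)}
        mul_mem' := by
          intro x y hx hy
          simp only [Set.mem_ofPred_eq] at hx hy ⊢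
          have e1 : ν.map (a * (x * y) * ·) = (ν.map (a * x * ·)).map (y * ·) := by
            rw [Measure.map_map (hc _).measurable (hc _).measurable]
            congr 1
            funext z
            simp only [Function.comp]
            ac_rfl
          have e2 : ν.map (a * y * ·) = (ν.map (a * ·)).map (y * ·) := by
            rw [Measure.map_map (hc _).measurable (hc _).measurable]
            congr 1
            funext z
            simp only [Function.comp]
            ac_rfl
          rw [e1, hx, ← e2, hy] }
    obtain ⟨R, hR⟩ : ∃ R : ℕ, 1 / 2 < ν.map (a * ·) (Metric.closedBall a R) := by
      have hp := Measure.isProbabilityMeasure_map (μ := ν) (hc a).aemeasurable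
      have hmono : Monotone fun R : ℕ => Metric.closedBall a (R : ℝ) := fun i j hij =>
        Metric.closedBall_subset_closedBall (by exact_mod_cast hij)
      have ht := tendsto_measure_iUnion_atTop (μ := ν.map (a * ·)) hmono
      rw [Metric.iUnion_closedBall_nat, measure_univ] at ht
      exact (ht.eventually_const_lt (by simp)).exists
    refine hnorm.displacement_eq_zero hG P (C := 2 * R) (fun x hx => ?_)
      (map_mul_eq_of_mem_support ν ρ h haw)
    have hx' : ν.map (a * x * ·) = ν.map (a * ·) := hx
    -- Both `a * z` and `a * x * z` are within `R` of `a` for some `z`.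
    have h1 := hR
    have h2 := hR
    rw [Measure.map_apply (hc _).measurable Metric.isClosed_closedBall.measurableSet] at h1
    rw [← hx', Measure.map_apply (hc _).measurable
      Metric.isClosed_closedBall.measurableSet] at h2
    obtain ⟨z, hz1, hz2⟩ : ((fun z => a * z) ⁻¹' Metric.closedBall a R ∩
        (fun z => a * x * z) ⁻¹' Metric.closedBall a R).Nonempty := by
      refine nonempty_inter_of_measure_lt_add ν
        ((hc _).measurable Metric.isClosed_closedBall.measurableSet)
        (Set.subset_univ _) (Set.subset_univ _) ?_
      rw [measure_univ, ← ENNReal.add_halves 1]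
      exact ENNReal.add_lt_add h1 h2
    have h3 := dist_triangle_right (a * z) (a * x * z) a
    rw [show a * x * z = a * z * x by ac_rfl, hG.dist_self_mul] at h3
    simp only [Set.mem_preimage, Metric.mem_closedBall] at hz1 hz2
    rw [show a * x * z = a * z * x by ac_rfl] at hz2
    linarith
  have hm : MeasurableSet {w : G | displacement w = 0} :=
    (isClosed_eq hG.continuous_displacement continuous_const).measurableSet
  have hsnd : (ν.prod ρ).map Prod.snd = ρ := by simp
  rw [← hsnd]
  exact (ae_map_iff measurable_snd.aemeasurable hm).2 hsupp

/-! ### Blocks of partial products -/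

/-- The product `X m * X (m + 1) * ⋯ * X (m + j)` of `j + 1` consecutive factors. -/
def blockProd {Ω G : Type*} [Semigroup G] (X : ℕ → Ω → G) (m j : ℕ) : Ω → G :=
  partialProd (fun i => X (m + i)) j

lemma partialProd_mul_blockProd {Ω G : Type*} [Semigroup G] (X : ℕ → Ω → G) (k j : ℕ) (ω : Ω) :
    partialProd X k ω * blockProd X (k + 1) j ω = partialProd X (k + 1 + j) ω := by
  induction j with
  | zero => rfl
  | succ j ih =>
    change _ * (blockProd X (k + 1) j ω * X (k + 1 + (j + 1)) ω) = _
    rw [← mul_assoc, ih]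
    rfl

lemma blockProd_shift {Ω G : Type*} [Semigroup G] (X : ℕ → Ω → G) (m k j : ℕ) :
    blockProd (fun i => X (m + i)) k j = blockProd X (m + k) j := by
  simp only [blockProd, add_assoc]

lemma measurable_partialProd {Ω G : Type*} [Semigroup G] [MeasurableSpace G] [MeasurableMul₂ G]
    {_ : MeasurableSpace Ω} {X : ℕ → Ω → G} {n : ℕ} (hX : ∀ i ≤ n, Measurable (X i)) :
    Measurable (partialProd X n) := by
  induction n with
  | zero => exact hX 0 le_rfl
  | succ n ih => exact (ih fun i hi => hX i (by omega)).mul (hX _ le_rfl)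

section Independence

variable {Ω G : Type*} [MeasurableSpace G]

/-- The σ-algebra generated by the `X i` with `i ∈ s`. -/
abbrev sigmaOf (X : ℕ → Ω → G) (s : Set ℕ) : MeasurableSpace Ω :=
  ⨆ i ∈ s, MeasurableSpace.comap (X i) inferInstance

lemma measurable_sigmaOf (X : ℕ → Ω → G) {s : Set ℕ} {i : ℕ} (hi : i ∈ s) :
    Measurable[sigmaOf X s] (X i) :=
  (comap_measurable (X i)).mono (le_iSup₂_of_le i hi le_rfl) le_rfl

lemma measurable_sigmaOf_partialProd [Semigroup G] [MeasurableMul₂ G] (X : ℕ → Ω → G) {i k : ℕ}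
    (hik : i ≤ k) :
    Measurable[sigmaOf X (Set.Iic k)] (partialProd X i) :=
  measurable_partialProd fun _ hj => measurable_sigmaOf X (hj.trans hik)

lemma measurable_sigmaOf_blockProd [Semigroup G] [MeasurableMul₂ G] (X : ℕ → Ω → G) (k j : ℕ) :
    Measurable[sigmaOf X (Set.Ioi k)] (blockProd X (k + 1) j) :=
  measurable_partialProd fun i _ => measurable_sigmaOf X (show k < k + 1 + i by omega)

variable [MeasurableSpace Ω]

lemma indep_sigmaOf {μ : Measure Ω} {X : ℕ → Ω → G} (hX : ∀ n, Measurable (X n))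
    (hindep : iIndepFun X μ) (k : ℕ) :
    Indep (sigmaOf X (Set.Iic k)) (sigmaOf X (Set.Ioi k)) μ :=
  indep_iSup_of_disjoint (fun i => (hX i).comap_le)
    ((iIndepFun_iff_iIndep _ X μ).1 hindep) (Set.Iic_disjoint_Ioi le_rfl)

lemma indepFun_partialProd_blockProd [Semigroup G] [MeasurableMul₂ G] {μ : Measure Ω}
    {X : ℕ → Ω → G} (hX : ∀ n, Measurable (X n)) (hindep : iIndepFun X μ) (k j : ℕ) :
    IndepFun (partialProd X k) (blockProd X (k + 1) j) μ :=
  indep_of_indep_of_le_left (indep_of_indep_of_le_right (indep_sigmaOf hX hindep k)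
    (measurable_sigmaOf_blockProd X k j).comap_le)
    (measurable_sigmaOf_partialProd X le_rfl).comap_le

end Independence

/-! ### From convergence in probability to almost sure convergence -/

section Ottaviani

variable {Ω G : Type*} [MeasurableSpace Ω] [CommSemigroup G] [MetricSpace G]
  [SecondCountableTopology G] [MeasurableSpace G] [BorelSpace G]

/-- The **Lévy–Ottaviani inequality** in a metric semigroup. -/
lemma measure_exists_le_displacement_partialProd_le (hG : IsMetricSemigroup G) {μ : Measure Ω}
    [IsProbabilityMeasure μ] {X : ℕ → Ω → G} (hX : ∀ n, Measurable (X n))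
    (hindep : iIndepFun X μ) {ε : ℝ} (hε : 0 ≤ ε)
    (hδ : ∀ k j, μ {ω | ε ≤ displacement (blockProd X (k + 1) j ω)} ≤ 1 / 2) (N : ℕ) :
    μ {ω | ∃ k ≤ N, 2 * ε ≤ displacement (partialProd X k ω)} ≤
      2 * μ {ω | ε ≤ displacement (partialProd X N ω)} := by
  have := hG.continuousMul
  have hdisp : Measurable (displacement : G → ℝ) := hG.continuous_displacement.measurable
  set C : Set Ω := {ω | ε ≤ displacement (partialProd X N ω)} with hC
  -- The event that `k` is the first index at which the displacement reaches `2 * ε`.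
  let A (k : ℕ) : Set Ω := {ω | 2 * ε ≤ displacement (partialProd X k ω) ∧
    ∀ i < k, displacement (partialProd X i ω) < 2 * ε}
  have hle (k : ℕ) : sigmaOf X (Set.Iic k) ≤ ‹MeasurableSpace Ω› :=
    iSup₂_le fun i _ => (hX i).comap_le
  have hAm (k : ℕ) : MeasurableSet[sigmaOf X (Set.Iic k)] (A k) := by
    have h1 (i : ℕ) (hi : i ≤ k) :
        Measurable[sigmaOf X (Set.Iic k)] fun ω => displacement (partialProd X i ω) :=
      hdisp.comp (measurable_sigmaOf_partialProd X hi)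
    have h2 : A k = (fun ω => displacement (partialProd X k ω)) ⁻¹' Set.Ici (2 * ε) ∩
        ⋂ i ∈ Set.Iio k, (fun ω => displacement (partialProd X i ω)) ⁻¹' Set.Iio (2 * ε) := by
      ext ω
      simp [A]
    rw [h2]
    exact MeasurableSet.inter (h1 k le_rfl measurableSet_Ici)
      (MeasurableSet.biInter (Set.to_countable _) fun i hi => h1 i (le_of_lt hi) measurableSet_Iio)
  have hCm : MeasurableSet C :=
    (hdisp.comp (measurable_partialProd fun i _ => hX i)) measurableSet_Ici
  have hstep (k : ℕ) (hk : k ≤ N) : μ (A k) ≤ 2 * μ (A k ∩ C) := by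
    obtain rfl | hlt := hk.eq_or_lt
    · have hsub : A k ⊆ C := fun ω hω => by
        have := hω.1
        change ε ≤ _
        linarith
      rw [Set.inter_eq_left.2 hsub, two_mul]
      exact le_self_add
    obtain ⟨j, rfl⟩ := Nat.exists_eq_add_of_le (Nat.succ_le_of_lt hlt)
    set B : Set Ω := {ω | ε ≤ displacement (blockProd X (k + 1) j ω)} with hB
    have hBm' : MeasurableSet[sigmaOf X (Set.Ioi k)] B :=
      (hdisp.comp (measurable_sigmaOf_blockProd X k j)) measurableSet_Ici
    have hBm : MeasurableSet B :=
      (hdisp.comp (measurable_partialProd fun i _ => hX _)) measurableSet_Ici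
    have hBc : 1 / 2 ≤ μ Bᶜ := by
      rw [prob_compl_eq_one_sub hBm]
      refine ENNReal.le_sub_of_add_le_left (measure_ne_top _ _) ?_
      calc μ B + 1 / 2 ≤ 1 / 2 + 1 / 2 := by gcongr; exact hδ k j
        _ = 1 := ENNReal.add_halves 1
    have hind : μ (A k ∩ Bᶜ) = μ (A k) * μ Bᶜ :=
      (Indep_iff _ _ μ).1 (indep_sigmaOf hX hindep k) _ _ (hAm k)
        (MeasurableSet.compl hBm')
    have hsub : A k ∩ Bᶜ ⊆ A k ∩ C := by
      rintro ω ⟨h1, h2⟩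
      refine ⟨h1, ?_⟩
      have h3 := hG.displacement_le_add (partialProd X k ω) (blockProd X (k + 1) j ω)
      rw [partialProd_mul_blockProd] at h3
      have h4 := h1.1
      have h5 : displacement (blockProd X (k + 1) j ω) < ε := not_le.1 h2
      change ε ≤ displacement (partialProd X (k + 1 + j) ω)
      linarith
    calc μ (A k) = 2 * (μ (A k) * (1 / 2)) := by
          rw [mul_comm (μ (A k)), ← mul_assoc, ENNReal.mul_div_cancel (by simp) (by simp),
            one_mul]
      _ ≤ 2 * (μ (A k) * μ Bᶜ) := by gcongr
      _ = 2 * μ (A k ∩ Bᶜ) := by rw [hind]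
      _ ≤ 2 * μ (A k ∩ C) := by gcongr
  have hdisj : Pairwise (Function.onFun Disjoint fun k => A k ∩ C) := by
    have key (k l : ℕ) (h : k < l) : Disjoint (A k ∩ C) (A l ∩ C) :=
      Set.disjoint_left.2 fun ω h1 h2 => absurd h1.1.1 (not_le.2 (h2.1.2 k h))
    intro k l hkl
    rcases hkl.lt_or_gt with h | h
    · exact key k l h
    · exact (key l k h).symm
  have hcover : {ω | ∃ k ≤ N, 2 * ε ≤ displacement (partialProd X k ω)} ⊆
      ⋃ k ∈ Finset.range (N + 1), A k := by
    classical
    rintro ω ⟨k, hk, hω⟩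
    have hex : ∃ k, 2 * ε ≤ displacement (partialProd X k ω) := ⟨k, hω⟩
    have hfind := Nat.find_min' hex hω
    refine Set.mem_biUnion (x := Nat.find hex) ?_
      ⟨Nat.find_spec hex, fun i hi => not_le.1 (Nat.find_min hex hi)⟩
    exact Finset.mem_coe.2 (Finset.mem_range.2 (by omega))
  calc μ {ω | ∃ k ≤ N, 2 * ε ≤ displacement (partialProd X k ω)}
      ≤ μ (⋃ k ∈ Finset.range (N + 1), A k) := measure_mono hcover
    _ ≤ ∑ k ∈ Finset.range (N + 1), μ (A k) := measure_biUnion_finset_le _ _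
    _ ≤ ∑ k ∈ Finset.range (N + 1), 2 * μ (A k ∩ C) :=
        Finset.sum_le_sum fun k hk => hstep k (by simpa [Nat.lt_succ_iff] using hk)
    _ = 2 * μ (⋃ k ∈ Finset.range (N + 1), A k ∩ C) := by
        rw [← Finset.mul_sum, measure_biUnion_finset (hdisj.set_pairwise _)
          fun k _ => (hle k _ (hAm k)).inter hCm]
    _ ≤ 2 * μ C := by
        gcongr
        exact Set.iUnion₂_subset fun k _ => Set.inter_subset_right

/-- The partial products of `X` are Cauchy in probability: the blocks starting late are, whatever
their length, of small displacement with large probability. -/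
def CauchyInProbability (X : ℕ → Ω → G) (μ : Measure Ω) : Prop :=
  ∀ ε : ℝ, 0 < ε → ∀ δ : ENNReal, 0 < δ →
    ∃ M, ∀ m ≥ M, ∀ j, μ {ω | ε ≤ displacement (blockProd X (m + 1) j ω)} ≤ δ

lemma CauchyInProbability.convergesAlmostSurely [CompleteSpace G] (hG : IsMetricSemigroup G)
    {μ : Measure Ω} [IsProbabilityMeasure μ] {X : ℕ → Ω → G} (hX : ∀ n, Measurable (X n))
    (hindep : iIndepFun X μ) (h : CauchyInProbability X μ) :
    ConvergesAlmostSurely (partialProd X) μ := by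
  have key (q : ℕ) : ∀ᵐ ω ∂μ, ∃ M, ∀ k,
      displacement (blockProd X (M + 1) k ω) < 2 * (1 / ((q : ℝ) + 1)) := by
    have hε : (0 : ℝ) < 1 / ((q : ℝ) + 1) := by positivity
    set ε : ℝ := 1 / ((q : ℝ) + 1)
    rw [ae_iff]
    refine le_antisymm (ENNReal.le_of_forall_pos_le_add fun δ hδ _ => ?_) zero_le
    rw [zero_add]
    obtain ⟨M, hM⟩ := h ε hε (min (δ / 2) (1 / 2)) (by simp [hδ.ne'])
    have hott (N : ℕ) := measure_exists_le_displacement_partialProd_le hG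
      (X := fun i => X (M + 1 + i)) (fun n => hX _)
      (hindep.precomp (g := fun i => M + 1 + i) (add_right_injective _)) hε.le (fun k j => by
        rw [blockProd_shift, ← add_assoc]
        exact (hM _ (by omega) j).trans (min_le_right _ _)) N
    calc μ {ω | ¬∃ M, ∀ k, displacement (blockProd X (M + 1) k ω) < 2 * ε}
        ≤ μ (⋃ N : ℕ, {ω | ∃ k ≤ N, 2 * ε ≤ displacement (blockProd X (M + 1) k ω)}) := by
          refine measure_mono fun ω hω => ?_
          have hω' : ¬∃ M, ∀ k, displacement (blockProd X (M + 1) k ω) < 2 * ε := hω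
          push Not at hω'
          obtain ⟨k, hk⟩ := hω' M
          exact Set.mem_iUnion.2 ⟨k, k, le_rfl, hk⟩
      _ = ⨆ N : ℕ, μ {ω | ∃ k ≤ N, 2 * ε ≤ displacement (blockProd X (M + 1) k ω)} := by
          refine Monotone.measure_iUnion fun i j hij ω hω => ?_
          obtain ⟨k, hk, hω⟩ := hω
          exact ⟨k, hk.trans hij, hω⟩
      _ ≤ δ := by
          refine iSup_le fun N => (hott N).trans ?_
          calc 2 * μ {ω | ε ≤ displacement (blockProd X (M + 1) N ω)} ≤ 2 * (δ / 2) := by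
                gcongr
                exact (hM M le_rfl N).trans (min_le_left _ _)
            _ = δ := ENNReal.mul_div_cancel (by simp) (by simp)
  filter_upwards [ae_all_iff.2 key] with ω hω
  refine cauchySeq_tendsto_of_complete (Metric.cauchySeq_iff'.2 fun ε hε => ?_)
  obtain ⟨q, hq⟩ := exists_nat_one_div_lt (half_pos hε)
  obtain ⟨M, hM⟩ := hω q
  refine ⟨M, fun n hn => ?_⟩
  obtain rfl | hlt := hn.eq_or_lt
  · simpa using hε
  obtain ⟨k, rfl⟩ := Nat.exists_eq_add_of_le (Nat.succ_le_of_lt hlt)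
  rw [dist_comm, Nat.succ_eq_add_one, ← partialProd_mul_blockProd, hG.dist_self_mul]
  linarith [hM k]

end Ottaviani

/-! ### From convergence in distribution to the Cauchy property in probability -/

section Distribution

variable {Ω G : Type*} [MeasurableSpace Ω] [CommSemigroup G] [MetricSpace G]
  [SecondCountableTopology G] [MeasurableSpace G] [BorelSpace G] [CompleteSpace G]

/-- If the laws of the partial products form a tight family, then so do the laws of the blocks:
a block is a quotient of two partial products. -/
lemma isCompact_closure_range_map_blockProd (hG : IsMetricSemigroup G) {μ : Measure Ω}
    [IsProbabilityMeasure μ] {X : ℕ → Ω → G} (hX : ∀ n, Measurable (X n))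
    (law : ℕ → ProbabilityMeasure G) (hlaw : ∀ n, (law n : Measure G) = μ.map (partialProd X n))
    (hc : IsCompact (closure (Set.range law))) (m j : ℕ → ℕ) (ρ : ℕ → ProbabilityMeasure G)
    (hρ : ∀ i, (ρ i : Measure G) = μ.map (blockProd X (m i + 1) (j i))) :
    IsCompact (closure (Set.range ρ)) := by
  have := hG.continuousMul
  have hS (n : ℕ) : Measurable (partialProd X n) := measurable_partialProd fun i _ => hX i
  have hT (k l : ℕ) : Measurable (blockProd X k l) := measurable_partialProd fun i _ => hX _
  refine isCompact_closure_of_isTightMeasureSet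
    (isTightMeasureSet_iff_exists_isCompact_measure_compl_le.2 fun ε hε => ?_)
  obtain ⟨K, hK, hKε⟩ := isTightMeasureSet_iff_exists_isCompact_measure_compl_le.1
    (isTightMeasureSet_of_isCompact_closure hc) (ε / 2) (ENNReal.half_pos hε.ne')
  have hKS (n : ℕ) : μ (partialProd X n ⁻¹' Kᶜ) ≤ ε / 2 := by
    rw [← Measure.map_apply (hS n) hK.isClosed.measurableSet.compl, ← hlaw]
    exact hKε _ ⟨law n, ⟨n, rfl⟩, rfl⟩
  have hK' := hG.isCompact_setOf_mul_mem hK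
  refine ⟨_, hK', ?_⟩
  rintro _ ⟨_, ⟨i, rfl⟩, rfl⟩
  rw [hρ, Measure.map_apply (hT _ _) hK'.isClosed.measurableSet.compl]
  calc _ ≤ μ (partialProd X (m i) ⁻¹' Kᶜ ∪ partialProd X (m i + 1 + j i) ⁻¹' Kᶜ) := by
        refine measure_mono fun ω hω => ?_
        by_contra hcon
        simp only [Set.mem_union, Set.mem_preimage, Set.mem_compl_iff, not_or, not_not] at hcon
        refine hω ⟨_, hcon.1, ?_⟩
        rw [partialProd_mul_blockProd]
        exact hcon.2
    _ ≤ ε / 2 + ε / 2 := (measure_union_le _ _).trans (add_le_add (hKS _) (hKS _))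
    _ = ε := ENNReal.add_halves ε

/-- If the partial products converge in distribution to `ν`, a limit point `ρ` of the laws of
blocks starting later and later satisfies `ν ∗ ρ = ν`, so it is carried by the elements of
displacement zero. -/
lemma cauchyInProbability_of_tendsto_law (hG : IsMetricSemigroup G) (hnorm : IsNormedSemigroup G)
    {μ : Measure Ω} [IsProbabilityMeasure μ] {X : ℕ → Ω → G} (hX : ∀ n, Measurable (X n))
    (hindep : iIndepFun X μ) (law : ℕ → ProbabilityMeasure G)
    (hlaw : ∀ n, (law n : Measure G) = μ.map (partialProd X n)) (ν : ProbabilityMeasure G)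
    (hν : Tendsto law atTop (𝓝 ν)) : CauchyInProbability X μ := by
  have := hG.continuousMul
  have hS (n : ℕ) : Measurable (partialProd X n) := measurable_partialProd fun i _ => hX i
  have hT (k l : ℕ) : Measurable (blockProd X k l) := measurable_partialProd fun i _ => hX _
  intro ε hε δ hδ
  by_contra! hcon
  -- Otherwise the `i`-th of a sequence of blocks starts after `i` and has displacement at least `ε`
  -- with probability more than `δ`; a limit point of their laws gives `ε ≤ displacement w` mass at
  -- least `δ`.
  choose m hm j hj using hcon
  let ρ (i : ℕ) : ProbabilityMeasure G :=
    ⟨μ.map (blockProd X (m i + 1) (j i)),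
      Measure.isProbabilityMeasure_map (hT _ _).aemeasurable⟩
  have hc : IsCompact (closure (Set.range law)) :=
    hν.isCompact_insert_range.of_isClosed_subset isClosed_closure
      (closure_minimal (Set.subset_insert _ _) hν.isCompact_insert_range.isClosed)
  have hcρ := isCompact_closure_range_map_blockProd hG hX law hlaw hc m j ρ fun _ => rfl
  let U : Ultrafilter ℕ := Ultrafilter.of atTop
  have hU : (U : Filter ℕ) ≤ atTop := Ultrafilter.of_le _
  obtain ⟨ρ', -, hρ'⟩ := hcρ.ultrafilter_le_nhds (U.map ρ) (le_principal_iff.2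
    (mem_map.2 (univ_mem' fun i => subset_closure ⟨i, rfl⟩)))
  have hρlim : Tendsto ρ U (𝓝 ρ') := hρ'
  have hm_top : Tendsto m atTop atTop := tendsto_atTop_mono hm tendsto_id
  have hmj_top : Tendsto (fun i => m i + 1 + j i) atTop atTop :=
    tendsto_atTop_mono (fun i => (hm i).trans (by omega)) tendsto_id
  have hprod : Tendsto (fun i => (law (m i)).prod (ρ i)) U (𝓝 (ν.prod ρ')) :=
    (ProbabilityMeasure.continuous_prod.tendsto (ν, ρ')).comp
      (((hν.comp hm_top).mono_left hU).prodMk_nhds hρlim)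
  have hmap := ProbabilityMeasure.tendsto_map_of_tendsto_of_continuous _ _ hprod
    (continuous_mul (M := G))
  have heq (i : ℕ) : ((law (m i)).prod (ρ i)).map (continuous_mul (M := G)).measurable.aemeasurable
      = law (m i + 1 + j i) := by
    apply Subtype.ext
    change ((law (m i) : Measure G).prod (ρ i : Measure G)).map (fun p : G × G => p.1 * p.2)
      = (law (m i + 1 + j i) : Measure G)
    rw [hlaw, hlaw]
    change ((μ.map _).prod (μ.map _)).map _ = _
    rw [← (indepFun_iff_map_prod_eq_prod_map_map (hS _).aemeasurable (hT _ _).aemeasurable).1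
      (indepFun_partialProd_blockProd hX hindep (m i) (j i)),
      Measure.map_map measurable_mul ((hS _).prodMk (hT _ _))]
    congr 1
    funext ω
    exact partialProd_mul_blockProd X _ _ ω
  simp only [heq] at hmap
  have hinv := tendsto_nhds_unique hmap ((hν.comp hmj_top).mono_left hU)
  have hzero := ae_displacement_eq_zero hG hnorm (ν : Measure G) (ρ' : Measure G)
    (congrArg Subtype.val hinv)
  have hF : IsClosed {w : G | ε ≤ displacement w} :=
    isClosed_le continuous_const hG.continuous_displacement
  have hF0 : (ρ' : Measure G) {w : G | ε ≤ displacement w} = 0 := by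
    refine measure_mono_null (fun w hw => ?_) (ae_iff.1 hzero)
    exact (hε.trans_le hw).ne'
  have hlim := ProbabilityMeasure.limsup_measure_closed_le_of_tendsto hρlim hF
  rw [hF0] at hlim
  refine absurd (le_trans ?_ hlim) (not_le.2 hδ)
  have hge (i : ℕ) : δ ≤ (ρ i : Measure G) {w : G | ε ≤ displacement w} := by
    change δ ≤ μ.map _ _
    rw [Measure.map_apply (hT _ _) hF.measurableSet]
    exact (hj i).le
  calc δ = limsup (fun _ : ℕ => δ) (U : Filter ℕ) := (limsup_const δ).symm
    _ ≤ _ := limsup_le_limsup (Eventually.of_forall hge)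

end Distribution

/-! ### Equivalence of the modes of convergence -/

lemma partialProd_ae_eq {Ω G : Type*} [MeasurableSpace Ω] [Semigroup G] {μ : Measure Ω}
    {X Y : ℕ → Ω → G} (h : ∀ n, X n =ᵐ[μ] Y n) (n : ℕ) : partialProd X n =ᵐ[μ] partialProd Y n := by
  induction n with
  | zero => exact h 0
  | succ n ih =>
    filter_upwards [ih, h (n + 1)] with ω h1 h2
    simp only [partialProd, h1, h2]

theorem mainTheorem7 {G : Type*} [CommSemigroup G] [MetricSpace G] [CompleteSpace G]
    [TopologicalSpace.SeparableSpace G] [MeasurableSpace G] [BorelSpace G]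
    (hG : IsMetricSemigroup G) (hnorm : IsNormedSemigroup G)
    {Ω : Type*} [MeasurableSpace Ω] (μ : Measure Ω) [IsProbabilityMeasure μ]
    (X : ℕ → Ω → G) (hX : ∀ n, AEMeasurable (X n) μ) (hindep : iIndepFun X μ) :
    (ConvergesAlmostSurely (partialProd X) μ ↔ ConvergesInProbability (partialProd X) μ) ∧
      (ConvergesInProbability (partialProd X) μ ↔ ConvergesInDistribution (partialProd X) μ) := by
  have := UniformSpace.secondCountable_of_separable G
  have := hG.continuousMul
  -- Measurable versions of the factors.
  let Y (n : ℕ) : Ω → G := (hX n).mk (X n)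
  have hY (n : ℕ) : Measurable (Y n) := (hX n).measurable_mk
  have hXY : ∀ n, X n =ᵐ[μ] Y n := fun n => (hX n).ae_eq_mk
  have hSY (n : ℕ) : Measurable (partialProd Y n) := measurable_partialProd fun i _ => hY i
  have hS (n : ℕ) : AEMeasurable (partialProd X n) μ :=
    (hSY n).aemeasurable.congr (partialProd_ae_eq hXY n).symm
  have h12 (h : ConvergesAlmostSurely (partialProd X) μ) :
      ConvergesInProbability (partialProd X) μ := by
    obtain ⟨Z, hZ, hlim⟩ := measurable_limit_of_tendsto_metrizable_ae hS h
    exact ⟨Z, hZ, tendstoInMeasure_of_tendsto_ae (fun n => (hS n).aestronglyMeasurable) hlim⟩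
  have h23 (h : ConvergesInProbability (partialProd X) μ) :
      ConvergesInDistribution (partialProd X) μ := by
    obtain ⟨Z, hZ, hlim⟩ := h
    have hd := hlim.tendstoInDistribution hS
    let ν : ProbabilityMeasure G := ⟨μ.map Z, Measure.isProbabilityMeasure_map hZ.aemeasurable⟩
    refine ⟨ν, ⟨hS, aemeasurable_id, ?_⟩⟩
    convert! hd.tendsto using 2
    exact congrArg 𝓝 (Subtype.ext Measure.map_id)
  have h31 (h : ConvergesInDistribution (partialProd X) μ) :
      ConvergesAlmostSurely (partialProd X) μ := by
    obtain ⟨ν, hd⟩ := h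
    have hindepY : iIndepFun Y μ := hindep.congr hXY
    have hcauchy : CauchyInProbability Y μ :=
      cauchyInProbability_of_tendsto_law hG hnorm hY hindepY
        (fun n => ⟨μ.map (partialProd X n), Measure.isProbabilityMeasure_map (hS n)⟩)
        (fun n => Measure.map_congr (partialProd_ae_eq hXY n)) _ hd.tendsto
    have hY_conv := hcauchy.convergesAlmostSurely hG hY hindepY
    filter_upwards [hY_conv, ae_all_iff.2 (partialProd_ae_eq hXY)] with ω hω heq
    simpa only [heq] using hω
  exact ⟨⟨h12, fun h => h31 (h23 h)⟩, ⟨h23, fun h => h12 (h31 h)⟩⟩
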